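/- Let $m,n\ge 0$ and $d\ge 1$ be integers and let $P\colon\mathbb R^m\to\mathbb R^n$ be a map whose components are homogeneous polynomials of degree $d$. Assume that $P$ is a harmonic morphism, i.e. for every open $U\subseteq\mathbb R^n$ and every harmonic $f\colon U\to\mathbb R$ the function $f\circ P$ is harmonic on $P^{-1}(U)$. Assume moreover that $P$ is umbilic, i.e. there is a function $\eta\colon\mathbb R^m\to\mathbb R$ with $$dP_x\bigl(\nabla\|dP\|^2(x)\bigr)=\eta(x)\,P(x)\qquad\text{for all }x\in\mathbb R^m,$$ where $\|dP\|^2=\operatorname{Tr}(dP^{T}dP)$. A submanifold is a (possibly empty, not necessarily closed) smooth embedded submanifold of constant codimension; it is minimal if its mean curvature vector vanishes at every point; a set $C$ is conical if $tC\subseteq C$ for all $t>0$. Then for every integer $p\ge 0$: 1. If $C\subset\mathbb R^n\setminus\{0\}$ is a conical minimal submanifold of codimension $p$ in $\mathbb R^n\setminus\{0\}$, then $P^{-1}(C)$ is contained in $\mathbb R^m\setminus\{0\}$ and is a conical minimal submanifold of codimension $p$ in $\mathbb R^m\setminus\{0\}$. 2. If $B\subset S^{n-1}$ is a minimal submanifold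 of codimension $p$ in the unit sphere $S^{n-1}$, then $P^{-1}(\mathbb R_{>0}\cdot B)\cap S^{m-1}$ is a minimal submanifold of codimension $p$ in the unit sphere $S^{m-1}$. -/

import Mathlib

open scoped Pointwise ContDiff

noncomputable section

/-! ### Embedded submanifolds and their mean curvature

The ambient manifold `M` is a smooth embedded submanifold of a Euclidean space `E`, with the induced
Riemannian metric; below it is either the open set `E \ {0}` or the unit sphere of `E`. -/

section Submanifolds

variable {E : Type*} [NormedAddCommGroup E] [InnerProductSpace ℝ E] [FiniteDimensional ℝ E]

/-- The tangent space at `x` of a subset `S` of a Euclidean space, as a linear subspace of `E`: the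
span of the tangent cone. When `S` is an embedded submanifold, the tangent cone is already a linear
subspace, the usual tangent space, consisting of the velocities at `x` of the curves in `S`. -/
def tangentSpaceAt (S : Set E) (x : E) : Submodule ℝ E :=
  Submodule.span ℝ (tangentConeAt ℝ S x)

/-- The orthogonal projection of `E` onto the tangent space of `S` at `x`. -/
def tangentProj (S : Set E) (x : E) : E →L[ℝ] E :=
  (tangentSpaceAt S x).starProjection

/-- `S` is a smooth embedded submanifold of `M` of codimension `p`: it is a subset of `M` which near
each of its points is cut out from `M` by `p` smooth equations with linearly independent
differentials on the tangent space of `M`. It need not be closed in `M`, nor connected, nor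
non-empty. -/
def IsSubmanifold (M : Set E) (p : ℕ) (S : Set E) : Prop :=
  S ⊆ M ∧ ∀ x ∈ S, ∃ (U : Set E) (F : E → EuclideanSpace ℝ (Fin p)),
    IsOpen U ∧ x ∈ U ∧ ContDiffOn ℝ ∞ F U ∧
    (∀ y ∈ U, y ∈ S ↔ y ∈ M ∧ F y = 0) ∧
    Set.SurjOn (fderiv ℝ F x) (tangentSpaceAt M x : Set E) Set.univ

/-- The Levi-Civita covariant derivative in `M` of a vector field `V` along `S ⊆ M`, in the
direction `u` tangent to `S` at `x`: the component tangential to `M` of the derivative of `V`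
along `S`. -/
def covDeriv (M S : Set E) (V : E → E) (x u : E) : E :=
  tangentProj M x (fderivWithin ℝ V S x u)

/-- The second fundamental form of `S` in `M` at `x`, for `u`, `v` tangent to `S` at `x`: the
component normal to `S` of the covariant derivative in `M`, in the direction `u`, of a vector field
tangent to `S` that extends `v`. The extension used is `y ↦ tangentProj S y v`. -/
def secondFundamentalForm (M S : Set E) (x u v : E) : E :=
  covDeriv M S (fun y => tangentProj S y v) x u -
    tangentProj S x (covDeriv M S (fun y => tangentProj S y v) x u)

/-- The mean curvature vector of `S` in `M` at `x`: the trace of the second fundamental form,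
computed in an orthonormal basis of the tangent space of `S`. -/
def meanCurvature (M S : Set E) (x : E) : E :=
  ∑ i, secondFundamentalForm M S x
    (stdOrthonormalBasis ℝ (tangentSpaceAt S x) i : E)
    (stdOrthonormalBasis ℝ (tangentSpaceAt S x) i : E)

/-- `S` is a minimal submanifold of `M` of codimension `p`. -/
def IsMinimalSubmanifold (M : Set E) (p : ℕ) (S : Set E) : Prop :=
  IsSubmanifold M p S ∧ ∀ x ∈ S, meanCurvature M S x = 0

/-- `C` is invariant under multiplication by positive scalars. -/
def IsConical (C : Set E) : Prop :=
  ∀ t : ℝ, 0 < t → ∀ x ∈ C, t • x ∈ C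

end Submanifolds

/-! ### Harmonic morphisms between Euclidean spaces -/

/-- `P` is a homogeneous polynomial map of degree `d`. -/
def IsHomogeneousPolynomialMap {m n : ℕ} (d : ℕ)
    (P : EuclideanSpace ℝ (Fin m) → EuclideanSpace ℝ (Fin n)) : Prop :=
  ∃ q : Fin n → MvPolynomial (Fin m) ℝ, (∀ i, (q i).IsHomogeneous d) ∧
    ∀ x i, P x i = MvPolynomial.eval (fun j => x j) (q i)

/-- `P` pulls back harmonic functions on open sets to harmonic functions. -/
def IsHarmonicMorphism {m n : ℕ}
    (P : EuclideanSpace ℝ (Fin m) → EuclideanSpace ℝ (Fin n)) : Prop :=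
  ∀ (U : Set (EuclideanSpace ℝ (Fin n))) (f : EuclideanSpace ℝ (Fin n) → ℝ), IsOpen U →
    InnerProductSpace.HarmonicOnNhd f U → InnerProductSpace.HarmonicOnNhd (f ∘ P) (P ⁻¹' U)

/-- The squared Hilbert-Schmidt norm of the differential of `P` at `x`. -/
def hilbertSchmidtSq {m n : ℕ}
    (P : EuclideanSpace ℝ (Fin m) → EuclideanSpace ℝ (Fin n)) (x : EuclideanSpace ℝ (Fin m)) : ℝ :=
  ∑ j, ‖fderiv ℝ P x (EuclideanSpace.basisFun (Fin m) ℝ j)‖ ^ 2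

/-- `P` is umbilic: the differential of `P` maps the gradient of its own squared Hilbert-Schmidt norm
to a multiple of `P`, at every point. -/
def IsUmbilic {m n : ℕ}
    (P : EuclideanSpace ℝ (Fin m) → EuclideanSpace ℝ (Fin n)) : Prop :=
  ∃ η : EuclideanSpace ℝ (Fin m) → ℝ,
    ∀ x, fderiv ℝ P x (gradient (hilbertSchmidtSq P) x) = η x • P x

end

/-! Minimality is read off from local equations. If `S` is cut out near `x` in flat space by `F`
with `dF` onto, the mean curvature vector `H` is normal and `dF(H)` is minus the trace of `D²F` over
`ker dF`; as `dF` is injective on normal vectors, `H = 0` iff that trace vanishes. On the unit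
sphere the criterion is the same when `F` has vanishing first and second radial derivatives at `x`.
This gives the passage between cones and their links, and so reduces claim 2 to claim 1
(`IsMinimalSubmanifold.cone`, `IsMinimalSubmanifold.inter_sphere`).

For claim 1, put `A = dP_x`, `s = D²P_x`, `L = dF` at `P x`. Testing `P` on linear functions and on
harmonic quadratic forms gives `ΔP = 0` and `A Aᵀ = c • id`, with `c ≠ 0` by Euler's identity. The
second derivative of `F ∘ P` is `D²F(A·, A·) + L ∘ s`. Over `ker (L ∘ A)` the first term has trace
`c` times that of `D²F` over `ker L`, which is zero. Since `ΔP = 0`, the second has minus its trace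
over the orthogonal complement `Aᵀ((ker L)ᗮ)`. This vanishes if `⟪ξ, s(Aᵀζ, Aᵀζ)⟫ = 0` for all `ξ,
ζ` normal to `C`. Normals to a cone are orthogonal to `P x`, so umbilicity kills the derivative of
`‖dP‖²` along `Aᵀξ` and `Aᵀζ`; differentiating the conformality relation then gives the claim
(`inner_fderiv_fderiv_eq_zero`, `traceOn_ker_comp`). -/

noncomputable section

open Filter Topology
open scoped InnerProductSpace

set_option linter.unusedSectionVars false

/-! ### Local equations, tangent spaces and mean curvature -/

section Submanifolds

variable {E W V : Type*}
  [NormedAddCommGroup E] [InnerProductSpace ℝ E] [FiniteDimensional ℝ E]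
  [NormedAddCommGroup W] [InnerProductSpace ℝ W] [FiniteDimensional ℝ W]
  [NormedAddCommGroup V] [NormedSpace ℝ V]

/-- `G` is a defining map of `S` near `x`: it is twice continuously differentiable, its differential
is onto, and its zero set coincides with `S` near `x`. -/
structure IsDefiningMapAt (S : Set E) (G : E → W) (x : E) : Prop where
  contDiffAt : ContDiffAt ℝ 2 G x
  mem_iff : ∀ᶠ y in 𝓝 x, y ∈ S ↔ G y = 0
  surjective : Function.Surjective (fderiv ℝ G x)

/-- Taking adjoints, as a continuous real-linear map. -/
def realAdjoint : (E →L[ℝ] W) →L[ℝ] (W →L[ℝ] E) :=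
  LinearMap.toContinuousLinearMap
    { toFun := fun A => ContinuousLinearMap.adjoint A
      map_add' := fun A B => map_add _ A B
      map_smul' := fun c A => by simp }

theorem inner_realAdjoint_left (A : E →L[ℝ] W) (w : W) (v : E) :
    ⟪realAdjoint A w, v⟫_ℝ = ⟪w, A v⟫_ℝ :=
  ContinuousLinearMap.adjoint_inner_left A v w

theorem inner_realAdjoint_right (A : E →L[ℝ] W) (w : W) (v : E) :
    ⟪v, realAdjoint A w⟫_ℝ = ⟪A v, w⟫_ℝ :=
  ContinuousLinearMap.adjoint_inner_right A v w

theorem isUnit_comp_realAdjoint {A : E →L[ℝ] W} (hA : Function.Surjective A) :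
    IsUnit (A ∘L realAdjoint A : W →L[ℝ] W) := by
  have hinj : Function.Injective (A ∘L realAdjoint A : W →L[ℝ] W) := by
    rw [injective_iff_map_eq_zero]
    intro w hw
    have h1 : realAdjoint A w = 0 := by
      rw [← inner_self_eq_zero (𝕜 := ℝ), inner_realAdjoint_left]
      simp only [ContinuousLinearMap.comp_apply] at hw
      rw [hw, inner_zero_right]
    obtain ⟨v, rfl⟩ := hA w
    rw [← inner_self_eq_zero (𝕜 := ℝ), ← inner_realAdjoint_left, h1, inner_zero_left]
  rw [ContinuousLinearMap.isUnit_iff_bijective]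
  exact ⟨hinj, LinearMap.injective_iff_surjective (f := (A ∘L realAdjoint A : W →L[ℝ] W).toLinearMap)
    |>.1 hinj⟩

/-- Units form an open set, so this makes surjectivity of the differential an open condition. -/
theorem surjective_of_isUnit_comp_realAdjoint {A : E →L[ℝ] W}
    (hA : IsUnit (A ∘L realAdjoint A : W →L[ℝ] W)) : Function.Surjective A := by
  rw [ContinuousLinearMap.isUnit_iff_bijective] at hA
  exact Function.Surjective.of_comp hA.2

/-- The orthogonal projection onto the kernel of a surjective linear map. -/
def kerProj (A : E →L[ℝ] W) : E →L[ℝ] E :=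
  ContinuousLinearMap.id ℝ E -
    realAdjoint A ∘L (Ring.inverse (A ∘L realAdjoint A : W →L[ℝ] W) ∘L A)

/-- The closed formula `1 - Aᵀ(AAᵀ)⁻¹A` shows that the projection depends differentiably on `A`. -/
theorem starProjection_ker {A : E →L[ℝ] W} (hA : Function.Surjective A) :
    A.ker.starProjection = kerProj A := by
  ext v
  apply Submodule.eq_starProjection_of_mem_orthogonal
  · have h := congrArg (fun T : W →L[ℝ] W => T (A v))
      (Ring.mul_inverse_cancel _ (isUnit_comp_realAdjoint hA))
    have h' : A (realAdjoint A (Ring.inverse (A ∘L realAdjoint A : W →L[ℝ] W) (A v))) = A v := h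
    simp [kerProj, LinearMap.mem_ker, h']
  · rw [Submodule.mem_orthogonal']
    intro u hu
    have hu' : A u = 0 := hu
    simp [kerProj, inner_realAdjoint_left, hu']

theorem differentiableAt_kerProj {A : E → E →L[ℝ] W} {x : E} (hA : DifferentiableAt ℝ A x)
    (hs : Function.Surjective (A x)) : DifferentiableAt ℝ (fun y => kerProj (A y)) x := by
  have h1 : DifferentiableAt ℝ (fun y => realAdjoint (A y)) x :=
    (realAdjoint (E := E) (W := W)).differentiableAt.comp x hA
  have h2 : DifferentiableAt ℝ (fun y => (A y ∘L realAdjoint (A y) : W →L[ℝ] W)) x :=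
    hA.clm_comp h1
  have h3 : DifferentiableAt ℝ
      (fun y => Ring.inverse (A y ∘L realAdjoint (A y) : W →L[ℝ] W)) x :=
    h2.inverse (isUnit_comp_realAdjoint hs)
  exact (differentiableAt_const _).sub (h1.clm_comp (h3.clm_comp hA))

theorem tangentConeAt_subset_tangentSpaceAt (S : Set E) (x : E) :
    tangentConeAt ℝ S x ⊆ tangentSpaceAt S x := Submodule.subset_span

/-- Derivatives within `S` need not be unique, but on tangent vectors they are, so the choice made
by `fderivWithin` is harmless there. -/
theorem HasFDerivWithinAt.eq_of_mem_tangentSpaceAt {f : E → V} {f' g' : E →L[ℝ] V} {S : Set E}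
    {x u : E} (hf : HasFDerivWithinAt f f' S x) (hg : HasFDerivWithinAt f g' S x)
    (hu : u ∈ tangentSpaceAt S x) : f' u = g' u :=
  LinearMap.eqOn_span (f := f'.toLinearMap) (g := g'.toLinearMap) (hf.unique_on hg) hu

theorem fderiv_apply_eq_zero_of_mem_tangentSpaceAt {f : E → V} {S : Set E} {x u : E}
    (hf : DifferentiableAt ℝ f x) (hx : x ∈ S) (h0 : ∀ᶠ y in 𝓝 x, y ∈ S → f y = 0)
    (hu : u ∈ tangentSpaceAt S x) : fderiv ℝ f x u = 0 := by
  have h1 : HasFDerivWithinAt f (0 : E →L[ℝ] V) S x :=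
    (hasFDerivWithinAt_const (0 : V) x S).congr_of_eventuallyEq
      (by filter_upwards [mem_nhdsWithin_of_mem_nhds h0, self_mem_nhdsWithin] with y h hy using h hy)
      (h0.self_of_nhds hx)
  exact hf.hasFDerivAt.hasFDerivWithinAt.eq_of_mem_tangentSpaceAt h1 hu

theorem tangentProj_eq_starProjection {S : Set E} {x : E} {T : Submodule ℝ E}
    (h : tangentSpaceAt S x = T) : tangentProj S x = T.starProjection := by
  subst h
  rfl

theorem tangentSpaceAt_of_mem_nhds {S : Set E} {x : E} (h : S ∈ 𝓝 x) : tangentSpaceAt S x = ⊤ := by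
  rw [tangentSpaceAt, tangentConeAt_of_mem_nhds h, Submodule.span_univ]

namespace IsDefiningMapAt

variable {S : Set E} {G : E → W} {x : E}

theorem differentiableAt (h : IsDefiningMapAt S G x) : DifferentiableAt ℝ G x :=
  h.contDiffAt.differentiableAt (by norm_num)

theorem differentiableAt_fderiv (h : IsDefiningMapAt S G x) :
    DifferentiableAt ℝ (fderiv ℝ G) x :=
  (h.contDiffAt.fderiv_right (m := 1) (by norm_num)).differentiableAt (by norm_num)

theorem tangentSpaceAt_eq (h : IsDefiningMapAt S G x) (hx : x ∈ S) :
    tangentSpaceAt S x = (fderiv ℝ G x).ker := by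
  apply le_antisymm
  · intro u hu
    exact fderiv_apply_eq_zero_of_mem_tangentSpaceAt h.differentiableAt hx
      (h.mem_iff.mono fun y hy => hy.1) hu
  · intro u hu
    apply tangentConeAt_subset_tangentSpaceAt
    have hs : HasStrictFDerivAt G (fderiv ℝ G x) x := h.contDiffAt.hasStrictFDerivAt (by norm_num)
    have hr : (fderiv ℝ G x).range = ⊤ := LinearMap.range_eq_top.2 h.surjective
    have hGx : G x = 0 := h.mem_iff.self_of_nhds.1 hx
    -- The implicit function parametrises the fibre of `G` by the kernel, with derivative the
    -- inclusion at `0`, so every kernel vector is tangent to `S`.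
    set φ := hs.implicitFunction G (fderiv ℝ G x) hr with hφ
    have h0 : φ (G x) 0 = x := hs.implicitFunction_apply_image hr
    have hd : HasFDerivAt (φ (G x)) (fderiv ℝ G x).ker.subtypeL 0 :=
      (hs.to_implicitFunction hr).hasFDerivAt
    have hmem : ∀ᶠ k in 𝓝 (0 : (fderiv ℝ G x).ker), φ (G x) k ∈ S := by
      have h1 : Tendsto (fun k : (fderiv ℝ G x).ker => (G x, k)) (𝓝 0) (𝓝 (G x, 0)) := by
        exact (Continuous.prodMk_right (G x)).tendsto 0
      have h2 := h1.eventually (hs.map_implicitFunction_eq hr)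
      have h3 : Tendsto (φ (G x)) (𝓝 0) (𝓝 x) := by
        have := hd.continuousAt.tendsto
        rwa [h0] at this
      filter_upwards [h2, h3.eventually h.mem_iff] with k hk1 hk2
      exact hk2.2 (hk1.trans hGx)
    have hmaps := (hd.hasFDerivWithinAt (s := {k | φ (G x) k ∈ S})).mapsTo_tangent_cone
    rw [tangentConeAt_of_mem_nhds hmem] at hmaps
    have := hmaps (Set.mem_univ ⟨u, hu⟩)
    rw [h0] at this
    exact tangentConeAt_mono (Set.image_subset_iff.2 fun k hk => hk) this

theorem eventually (h : IsDefiningMapAt S G x) : ∀ᶠ y in 𝓝 x, IsDefiningMapAt S G y := by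
  have hc : ContinuousAt (fun y => (fderiv ℝ G y ∘L realAdjoint (fderiv ℝ G y) : W →L[ℝ] W)) x := by
    have h1 := h.differentiableAt_fderiv
    exact (h1.clm_comp ((realAdjoint (E := E) (W := W)).differentiableAt.comp x h1)).continuousAt
  have hu := hc.eventually (Units.isOpen.mem_nhds (isUnit_comp_realAdjoint h.surjective))
  filter_upwards [h.contDiffAt.eventually (by simp), h.mem_iff.eventually_nhds, hu] with y h1 h2 h3
  exact ⟨h1, h2, surjective_of_isUnit_comp_realAdjoint h3⟩

theorem differentiableWithinAt_tangentProj (h : IsDefiningMapAt S G x) (hx : x ∈ S) (v : E) :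
    DifferentiableWithinAt ℝ (fun y => tangentProj S y v) S x := by
  have h1 : DifferentiableAt ℝ (fun y => kerProj (fderiv ℝ G y) v) x :=
    (differentiableAt_kerProj h.differentiableAt_fderiv h.surjective).clm_apply
      (differentiableAt_const v)
  have h2 : ∀ y ∈ S, IsDefiningMapAt S G y → tangentProj S y v = kerProj (fderiv ℝ G y) v := by
    intro y hy hG
    rw [tangentProj_eq_starProjection (hG.tangentSpaceAt_eq hy), starProjection_ker hG.surjective]
  refine h1.differentiableWithinAt.congr_of_eventuallyEq ?_ (h2 x hx h)
  filter_upwards [mem_nhdsWithin_of_mem_nhds h.eventually, self_mem_nhdsWithin] with y hy hyS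
  exact h2 y hyS hy

/-- A function vanishing on `S` maps the derivative along `S` of the tangent projection to minus
its second derivative. -/
theorem fderiv_fderivWithin_tangentProj (h : IsDefiningMapAt S G x) (hx : x ∈ S) {f : E → V}
    (hf : ContDiffAt ℝ 2 f x) (h0 : ∀ᶠ y in 𝓝 x, y ∈ S → f y = 0) {u v : E}
    (hu : u ∈ tangentSpaceAt S x) (hv : v ∈ tangentSpaceAt S x) :
    fderiv ℝ f x (fderivWithin ℝ (fun y => tangentProj S y v) S x u) =
      -fderiv ℝ (fderiv ℝ f) x u v := by
  have hdf : DifferentiableAt ℝ (fderiv ℝ f) x :=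
    (hf.fderiv_right (m := 1) (by norm_num)).differentiableAt (by norm_num)
  have h1 := hdf.hasFDerivAt.hasFDerivWithinAt.clm_apply
    (h.differentiableWithinAt_tangentProj hx v).hasFDerivWithinAt
  -- This identity holds along `S`; its derivative in the direction `u`, by the product rule, is the
  -- claim.
  have hzero : ∀ᶠ y in 𝓝 x, y ∈ S → fderiv ℝ f y (tangentProj S y v) = 0 := by
    filter_upwards [hf.eventually (by simp), h0.eventually_nhds] with y h1 h2 hy
    exact fderiv_apply_eq_zero_of_mem_tangentSpaceAt (h1.differentiableAt (by norm_num)) hy h2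
      (Submodule.starProjection_apply_mem _ v)
  have h2 : HasFDerivWithinAt (fun y => fderiv ℝ f y (tangentProj S y v)) (0 : E →L[ℝ] V) S x :=
    (hasFDerivWithinAt_const (0 : V) x S).congr_of_eventuallyEq
      (by filter_upwards [mem_nhdsWithin_of_mem_nhds hzero, self_mem_nhdsWithin] with y h hy
            using h hy)
      (hzero.self_of_nhds hx)
  have h3 := h1.eq_of_mem_tangentSpaceAt h2 hu
  have hpv : tangentProj S x v = v := Submodule.starProjection_eq_self_iff.2 hv
  simp only [add_apply, ContinuousLinearMap.comp_apply,
    ContinuousLinearMap.flip_apply, zero_apply, hpv] at h3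
  exact eq_neg_of_add_eq_zero_left h3

end IsDefiningMapAt

/-- The sum of `B v v` over an orthonormal basis of the subspace `T`. -/
def traceOn (T : Submodule ℝ E) (B : E →L[ℝ] E →L[ℝ] V) : V :=
  ∑ i, B (stdOrthonormalBasis ℝ T i : E) (stdOrthonormalBasis ℝ T i : E)

/-- Expand the first argument in `ε` and exchange the sums. The family `e` need not be orthonormal,
which later allows images under an adjoint. -/
theorem sum_apply_self_eq {ι κ : Type*} [Fintype ι] [Fintype κ] (ε : OrthonormalBasis κ ℝ E)
    (e : ι → E) (B : E →L[ℝ] E →L[ℝ] V) :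
    ∑ i, B (e i) (e i) = ∑ k, B (ε k) (∑ i, ⟪e i, ε k⟫_ℝ • e i) := by
  simp_rw [map_sum, map_smul]
  rw [Finset.sum_comm]
  refine Finset.sum_congr rfl fun i _ => ?_
  refine (congrArg (fun z => B z (e i)) (ε.sum_repr' (e i)).symm).trans ?_
  simp only [map_sum, map_smul, sum_apply, smul_apply]
  exact Finset.sum_congr rfl fun k _ => by rw [real_inner_comm]

theorem starProjection_eq_sum (T : Submodule ℝ E) (v : E) :
    T.starProjection v =
      ∑ i, ⟪(stdOrthonormalBasis ℝ T i : E), v⟫_ℝ • (stdOrthonormalBasis ℝ T i : E) := by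
  rw [Submodule.starProjection_apply,
    (stdOrthonormalBasis ℝ T).orthogonalProjectionOnto_apply_eq_sum]
  simp

theorem traceOn_eq_sum {κ : Type*} [Fintype κ] (ε : OrthonormalBasis κ ℝ E) (T : Submodule ℝ E)
    (B : E →L[ℝ] E →L[ℝ] V) : traceOn T B = ∑ k, B (ε k) (T.starProjection (ε k)) := by
  rw [traceOn, sum_apply_self_eq ε]
  simp_rw [starProjection_eq_sum]

theorem eq_zero_of_mem_ker_orthogonal {A : E →L[ℝ] W} {v : E} (h1 : A v = 0)
    (h2 : ∀ u, A u = 0 → ⟪u, v⟫_ℝ = 0) : v = 0 :=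
  inner_self_eq_zero.1 (h2 v h1)

namespace IsDefiningMapAt

variable {S M : Set E} {G : E → W} {x : E}

/-- The mean curvature vector is orthogonal to `ker dG`, so it vanishes iff `dG` kills it; its image
is minus the trace. -/
theorem meanCurvature_eq_zero_iff_of_mem_nhds (h : IsDefiningMapAt S G x) (hx : x ∈ S)
    (hM : M ∈ 𝓝 x) :
    meanCurvature M S x = 0 ↔
      traceOn (tangentSpaceAt S x) (fderiv ℝ (fderiv ℝ G) x) = 0 := by
  have hT : ∀ w, tangentProj M x w = w := fun w => by
    rw [tangentProj_eq_starProjection (tangentSpaceAt_of_mem_nhds hM)]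
    exact Submodule.starProjection_eq_self_iff.2 Submodule.mem_top
  have hS := h.tangentSpaceAt_eq hx
  have hsecond : ∀ u v, secondFundamentalForm M S x u v =
      fderivWithin ℝ (fun y => tangentProj S y v) S x u -
        tangentProj S x (fderivWithin ℝ (fun y => tangentProj S y v) S x u) := fun u v => by
    simp only [secondFundamentalForm, covDeriv, hT]
  have hG : fderiv ℝ G x (meanCurvature M S x) =
      -traceOn (tangentSpaceAt S x) (fderiv ℝ (fderiv ℝ G) x) := by
    rw [meanCurvature, traceOn, map_sum, ← Finset.sum_neg_distrib]
    refine Finset.sum_congr rfl fun i _ => ?_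
    rw [hsecond, map_sub, h.fderiv_fderivWithin_tangentProj hx h.contDiffAt
      (h.mem_iff.mono fun y hy => hy.1) (Subtype.mem _) (Subtype.mem _), sub_eq_self]
    have : tangentProj S x (fderivWithin ℝ (fun y => tangentProj S y
      (stdOrthonormalBasis ℝ (tangentSpaceAt S x) i : E)) S x
      (stdOrthonormalBasis ℝ (tangentSpaceAt S x) i : E)) ∈ (fderiv ℝ G x).ker :=
      hS ▸ Submodule.starProjection_apply_mem _ _
    exact this
  constructor
  · intro h0
    rw [h0, map_zero] at hG
    exact neg_eq_zero.1 hG.symm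
  · intro h0
    rw [h0, neg_zero] at hG
    refine eq_zero_of_mem_ker_orthogonal hG fun u hu => ?_
    have hu' : u ∈ tangentSpaceAt S x := hS ▸ hu
    rw [meanCurvature, inner_sum]
    refine Finset.sum_eq_zero fun i _ => ?_
    rw [hsecond]
    exact Submodule.sub_starProjection_mem_orthogonal _ u hu'

end IsDefiningMapAt

end Submanifolds

/-! ### Minimality criteria in the punctured space and in the sphere -/

section MinimalSubmanifolds

variable {E W V : Type*}
  [NormedAddCommGroup E] [InnerProductSpace ℝ E] [FiniteDimensional ℝ E]
  [NormedAddCommGroup W] [InnerProductSpace ℝ W] [FiniteDimensional ℝ W]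
  [NormedAddCommGroup V] [NormedSpace ℝ V]

theorem ContDiffAt.two_of_infty {f : E → V} {x : E} (h : ContDiffAt ℝ ∞ f x) :
    ContDiffAt ℝ 2 f x :=
  contDiffAt_infty.1 h 2

theorem traceOn_eq_traceOn_inf_add {T : Submodule ℝ E} {x : E} (hx : x ∈ T) (hx1 : ‖x‖ = 1)
    (B : E →L[ℝ] E →L[ℝ] V) : traceOn T B = traceOn (T ⊓ (ℝ ∙ x)ᗮ) B + B x x := by
  have hproj : ∀ v, (T ⊓ (ℝ ∙ x)ᗮ).starProjection v = T.starProjection v - ⟪x, v⟫_ℝ • x := by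
    intro v
    have hres : ∀ u ∈ T, ⟪u, v - T.starProjection v⟫_ℝ = 0 :=
      Submodule.sub_starProjection_mem_orthogonal v
    apply Submodule.eq_starProjection_of_mem_orthogonal
    · refine Submodule.mem_inf.2
        ⟨T.sub_mem (T.starProjection_apply_mem v) (T.smul_mem _ hx),
          Submodule.mem_orthogonal_singleton_iff_inner_right.2 ?_⟩
      have := hres x hx
      rw [inner_sub_right] at this
      rw [inner_sub_right, inner_smul_right, real_inner_self_eq_norm_sq, hx1]
      linarith
    · rw [Submodule.mem_orthogonal]
      rintro u ⟨hu, hux⟩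
      have h1 := hres u hu
      have h2 : ⟪u, x⟫_ℝ = 0 := Submodule.mem_orthogonal_singleton_iff_inner_left.1 hux
      rw [← sub_add, inner_add_right, h1, inner_smul_right, h2]
      simp
  set ε := stdOrthonormalBasis ℝ E
  have hx : B x x = ∑ k, B (ε k) (⟪x, ε k⟫_ℝ • x) := by
    simpa using sum_apply_self_eq ε (fun _ : Unit => x) B
  rw [traceOn_eq_sum ε, traceOn_eq_sum ε, hx, ← Finset.sum_add_distrib]
  refine Finset.sum_congr rfl fun k _ => ?_
  rw [hproj, ← map_add, sub_add_cancel]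

theorem hasStrictFDerivAt_norm_sq_sub_one (x : E) :
    HasStrictFDerivAt (fun y : E => ‖y‖ ^ 2 - 1) (2 • innerSL ℝ x) x :=
  (hasStrictFDerivAt_norm_sq x).sub_const 1

theorem mem_sphere_iff_norm_sq_sub_one {y : E} :
    y ∈ Metric.sphere (0 : E) 1 ↔ ‖y‖ ^ 2 - 1 = 0 := by
  rw [mem_sphere_zero_iff_norm, sub_eq_zero, pow_eq_one_iff_of_nonneg (norm_nonneg y) two_ne_zero]

theorem isDefiningMapAt_sphere {x : E} (hx : x ∈ Metric.sphere (0 : E) 1) :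
    IsDefiningMapAt (Metric.sphere (0 : E) 1) (fun y : E => ‖y‖ ^ 2 - 1) x where
  contDiffAt := ((contDiff_norm_sq ℝ).sub contDiff_const).contDiffAt
  mem_iff := Eventually.of_forall fun y => mem_sphere_iff_norm_sq_sub_one
  surjective := fun r => ⟨(r / 2) • x, by
    rw [(hasStrictFDerivAt_norm_sq_sub_one x).hasFDerivAt.fderiv]
    have : ‖x‖ = 1 := by simpa using hx
    simp [this]⟩

theorem tangentSpaceAt_sphere {x : E} (hx : x ∈ Metric.sphere (0 : E) 1) :
    tangentSpaceAt (Metric.sphere (0 : E) 1) x = (ℝ ∙ x)ᗮ := by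
  rw [(isDefiningMapAt_sphere hx).tangentSpaceAt_eq hx,
    (hasStrictFDerivAt_norm_sq_sub_one x).hasFDerivAt.fderiv]
  ext u
  simp [LinearMap.mem_ker, Submodule.mem_orthogonal_singleton_iff_inner_right]

theorem tangentProj_sphere {x : E} (hx : x ∈ Metric.sphere (0 : E) 1) (v : E) :
    tangentProj (Metric.sphere (0 : E) 1) x v = v - ⟪x, v⟫_ℝ • x := by
  have hx1 : ‖x‖ = 1 := by simpa using hx
  rw [tangentProj_eq_starProjection (tangentSpaceAt_sphere hx),
    Submodule.starProjection_orthogonal_val, Submodule.starProjection_unit_singleton ℝ hx1]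

section Sphere

variable {S : Set E} {F : E → W} {x : E}

/-- Adjoining the equation of the sphere keeps the differential onto: `dF` kills `x`, so the radial
component can be adjusted freely. -/
theorem isDefiningMapAt_of_mem_sphere (hF : ContDiffAt ℝ 2 F x)
    (hmem : ∀ᶠ y in 𝓝 x, y ∈ S ↔ y ∈ Metric.sphere (0 : E) 1 ∧ F y = 0)
    (hsurj : Function.Surjective (fderiv ℝ F x)) (hFx : fderiv ℝ F x x = 0)
    (hx : x ∈ Metric.sphere (0 : E) 1) :
    IsDefiningMapAt S (fun y => WithLp.toLp 2 (F y, ‖y‖ ^ 2 - 1)) x ∧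
      ∀ v, fderiv ℝ (fun y => WithLp.toLp 2 (F y, ‖y‖ ^ 2 - 1)) x v =
        WithLp.toLp 2 (fderiv ℝ F x v, 2 * ⟪x, v⟫_ℝ) := by
  have hd : HasFDerivAt (fun y => WithLp.toLp 2 (F y, ‖y‖ ^ 2 - 1))
      ((WithLp.prodContinuousLinearEquiv 2 ℝ W ℝ).symm.toContinuousLinearMap ∘L
        (fderiv ℝ F x).prod (2 • innerSL ℝ x)) x :=
    (WithLp.prodContinuousLinearEquiv 2 ℝ W ℝ).symm.toContinuousLinearMap.hasFDerivAt.comp x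
      ((hF.differentiableAt (by norm_num)).hasFDerivAt.prodMk
        (hasStrictFDerivAt_norm_sq_sub_one x).hasFDerivAt)
  have hv : ∀ v, fderiv ℝ (fun y => WithLp.toLp 2 (F y, ‖y‖ ^ 2 - 1)) x v =
        WithLp.toLp 2 (fderiv ℝ F x v, 2 * ⟪x, v⟫_ℝ) := fun v => by
    rw [hd.fderiv]; simp
  refine ⟨⟨?_, ?_, ?_⟩, hv⟩
  · exact (WithLp.prodContinuousLinearEquiv 2 ℝ W ℝ).symm.contDiff.contDiffAt.comp x
      (hF.prodMk ((contDiff_norm_sq ℝ).sub contDiff_const).contDiffAt)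
  · filter_upwards [hmem] with y hy
    rw [hy, mem_sphere_iff_norm_sq_sub_one, WithLp.toLp_eq_zero, Prod.mk_eq_zero, and_comm]
  · intro w
    obtain ⟨u, hu⟩ := hsurj w.fst
    have hx1 : ‖x‖ = 1 := by simpa using hx
    refine ⟨u + (w.snd / 2 - ⟪x, u⟫_ℝ) • x, ?_⟩
    rw [hv, map_add, map_smul, hFx, hu, inner_add_right, inner_smul_right,
      real_inner_self_eq_norm_sq, hx1]
    apply (WithLp.ofLp_injective 2)
    ext
    · simp
    · simp; ring

theorem tangentSpaceAt_of_mem_sphere (hF : ContDiffAt ℝ 2 F x)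
    (hmem : ∀ᶠ y in 𝓝 x, y ∈ S ↔ y ∈ Metric.sphere (0 : E) 1 ∧ F y = 0)
    (hsurj : Function.Surjective (fderiv ℝ F x)) (hFx : fderiv ℝ F x x = 0) (hx : x ∈ S) :
    tangentSpaceAt S x = (fderiv ℝ F x).ker ⊓ (ℝ ∙ x)ᗮ := by
  obtain ⟨h, hv⟩ := isDefiningMapAt_of_mem_sphere hF hmem hsurj hFx (hmem.self_of_nhds.1 hx).1
  rw [h.tangentSpaceAt_eq hx]
  ext u
  rw [LinearMap.mem_ker, Submodule.mem_inf, LinearMap.mem_ker,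
    Submodule.mem_orthogonal_singleton_iff_inner_right]
  change fderiv ℝ (fun y => WithLp.toLp 2 (F y, ‖y‖ ^ 2 - 1)) x u = 0 ↔ fderiv ℝ F x u = 0 ∧ _
  rw [hv, WithLp.toLp_eq_zero, Prod.mk_eq_zero]
  simp

/-- Projecting to the sphere subtracts a multiple of `x`, which `dF` kills, so `dF` still sends the
mean curvature to minus the trace over the tangent space. Enlarging that space by `x` adds only
`D²F(x, x) = 0`. -/
theorem meanCurvature_sphere_eq_zero_iff (hF : ContDiffAt ℝ 2 F x)
    (hmem : ∀ᶠ y in 𝓝 x, y ∈ S ↔ y ∈ Metric.sphere (0 : E) 1 ∧ F y = 0)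
    (hsurj : Function.Surjective (fderiv ℝ F x)) (hFx : fderiv ℝ F x x = 0)
    (hFxx : fderiv ℝ (fderiv ℝ F) x x x = 0) (hx : x ∈ S) :
    meanCurvature (Metric.sphere (0 : E) 1) S x = 0 ↔
      traceOn (fderiv ℝ F x).ker (fderiv ℝ (fderiv ℝ F) x) = 0 := by
  have hxs := (hmem.self_of_nhds.1 hx).1
  have hx1 : ‖x‖ = 1 := by simpa using hxs
  obtain ⟨h, -⟩ := isDefiningMapAt_of_mem_sphere hF hmem hsurj hFx hxs
  have hS := tangentSpaceAt_of_mem_sphere hF hmem hsurj hFx hx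
  have hmemS : ∀ {u}, u ∈ tangentSpaceAt S x ↔ fderiv ℝ F x u = 0 ∧ ⟪x, u⟫_ℝ = 0 := fun {u} => by
    rw [hS, Submodule.mem_inf, Submodule.mem_orthogonal_singleton_iff_inner_right]; rfl
  rw [traceOn_eq_traceOn_inf_add (show x ∈ (fderiv ℝ F x).ker from hFx) hx1, hFxx, add_zero, ← hS]
  have hproj : ∀ w, tangentProj S x w ∈ tangentSpaceAt S x :=
    fun w => Submodule.starProjection_apply_mem _ _
  have hsecond : ∀ u ∈ tangentSpaceAt S x, ∀ v ∈ tangentSpaceAt S x,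
      fderiv ℝ F x (secondFundamentalForm (Metric.sphere (0 : E) 1) S x u v) =
        -fderiv ℝ (fderiv ℝ F) x u v := by
    intro u hu v hv
    rw [secondFundamentalForm, covDeriv, map_sub, (hmemS.1 (hproj _)).1, sub_zero,
      tangentProj_sphere hxs, map_sub, map_smul, hFx, smul_zero, sub_zero,
      h.fderiv_fderivWithin_tangentProj hx hF (hmem.mono fun y hy h => (hy.1 h).2) hu hv]
  have hradial : ∀ u v, ⟪x, secondFundamentalForm (Metric.sphere (0 : E) 1) S x u v⟫_ℝ = 0 := by
    intro u v
    rw [secondFundamentalForm, covDeriv, inner_sub_right, (hmemS.1 (hproj _)).2,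
      tangentProj_sphere hxs, inner_sub_right, inner_smul_right, real_inner_self_eq_norm_sq, hx1]
    simp
  have hnormal : ∀ t ∈ tangentSpaceAt S x, ∀ u v,
      ⟪t, secondFundamentalForm (Metric.sphere (0 : E) 1) S x u v⟫_ℝ = 0 := fun t ht u v =>
    Submodule.sub_starProjection_mem_orthogonal _ t ht
  have hG : fderiv ℝ F x (meanCurvature (Metric.sphere (0 : E) 1) S x) =
      -traceOn (tangentSpaceAt S x) (fderiv ℝ (fderiv ℝ F) x) := by
    rw [meanCurvature, traceOn, map_sum, ← Finset.sum_neg_distrib]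
    exact Finset.sum_congr rfl fun i _ => hsecond _ (Subtype.mem _) _ (Subtype.mem _)
  constructor
  · intro h0
    rw [h0, map_zero] at hG
    exact neg_eq_zero.1 hG.symm
  · intro h0
    rw [h0, neg_zero] at hG
    have hin : meanCurvature (Metric.sphere (0 : E) 1) S x ∈ tangentSpaceAt S x := by
      refine hmemS.2 ⟨hG, ?_⟩
      rw [meanCurvature, inner_sum]
      exact Finset.sum_eq_zero fun i _ => hradial _ _
    rw [← inner_self_eq_zero (𝕜 := ℝ)]
    conv_lhs => rw [meanCurvature, inner_sum]
    exact Finset.sum_eq_zero fun i _ => hnormal _ hin _ _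

end Sphere

theorem fderiv_smul_apply_eq_zero {F : E → V} {x : E} {s : ℝ} {c : V}
    (hF : DifferentiableAt ℝ F (s • x)) (h : ∀ᶠ t in 𝓝 s, F (t • x) = c) :
    fderiv ℝ F (s • x) x = 0 := by
  have h1 : HasDerivAt (fun t : ℝ => t • x) x s := by
    simpa using (hasDerivAt_id s).smul_const x
  have h2 := hF.hasFDerivAt.comp_hasDerivAt s h1
  have h3 : HasDerivAt (fun t : ℝ => F (t • x)) 0 s := (hasDerivAt_const s c).congr_of_eventuallyEq h
  exact h2.unique h3

theorem fderiv_self_eq_zero {F : E → V} {x : E} {c : V} (hF : DifferentiableAt ℝ F x)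
    (h : ∀ᶠ t in 𝓝 (1 : ℝ), F (t • x) = c) : fderiv ℝ F x x = 0 := by
  have := fderiv_smul_apply_eq_zero (s := 1) (x := x) (by rwa [one_smul]) h
  rwa [one_smul] at this

theorem fderiv_fderiv_self_eq_zero {F : E → V} {x : E} {c : V} (hF : ContDiffAt ℝ 2 F x)
    (h : ∀ᶠ t in 𝓝 (1 : ℝ), F (t • x) = c) : fderiv ℝ (fderiv ℝ F) x x x = 0 := by
  have hdf : DifferentiableAt ℝ (fderiv ℝ F) x :=
    (hF.fderiv_right (m := 1) (by norm_num)).differentiableAt (by norm_num)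
  have hev : ∀ᶠ t in 𝓝 (1 : ℝ), fderiv ℝ F (t • x) x = 0 := by
    have ht : Tendsto (fun t : ℝ => t • x) (𝓝 1) (𝓝 x) := by
      have : Continuous fun t : ℝ => t • x := by fun_prop
      simpa using this.tendsto 1
    filter_upwards [h.eventually_nhds, ht.eventually (hF.eventually (by simp))] with t h1 h2
    exact fderiv_smul_apply_eq_zero (h2.differentiableAt (by norm_num)) h1
  have h2 : DifferentiableAt ℝ (fun y => fderiv ℝ F y x) x :=
    hdf.clm_apply (differentiableAt_const x)
  have h3 := fderiv_self_eq_zero h2 hev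
  rw [fderiv_clm_apply hdf (differentiableAt_const x)] at h3
  simpa using h3

/-- The trace criterion holds for any local equation, so minimality may be tested on one chosen at
each point. -/
theorem isMinimalSubmanifold_compl_zero_iff {p : ℕ} {S : Set E} :
    IsMinimalSubmanifold {0}ᶜ p S ↔ S ⊆ {0}ᶜ ∧ ∀ x ∈ S,
      ∃ (U : Set E) (F : E → EuclideanSpace ℝ (Fin p)), IsOpen U ∧ x ∈ U ∧ ContDiffOn ℝ ∞ F U ∧
        (∀ y ∈ U, y ∈ S ↔ F y = 0) ∧ Function.Surjective (fderiv ℝ F x) ∧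
        traceOn (fderiv ℝ F x).ker (fderiv ℝ (fderiv ℝ F) x) = 0 := by
  have key : ∀ {x : E} {U : Set E} {F : E → EuclideanSpace ℝ (Fin p)}, x ∈ S → x ∈ ({0}ᶜ : Set E) →
      IsOpen U → x ∈ U → ContDiffOn ℝ ∞ F U → (∀ y ∈ U, y ∈ S ↔ F y = 0) →
      Function.Surjective (fderiv ℝ F x) → (meanCurvature {0}ᶜ S x = 0 ↔
        traceOn (fderiv ℝ F x).ker (fderiv ℝ (fderiv ℝ F) x) = 0) := by
    intro x U F hx hx0 hU hxU hF hmem hsurj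
    have h : IsDefiningMapAt S F x :=
      ⟨(hF.contDiffAt (hU.mem_nhds hxU)).two_of_infty,
        by filter_upwards [hU.mem_nhds hxU] using hmem, hsurj⟩
    rw [h.meanCurvature_eq_zero_iff_of_mem_nhds hx (isOpen_compl_singleton.mem_nhds hx0),
      h.tangentSpaceAt_eq hx]
  have htop : ∀ x ∈ ({0}ᶜ : Set E), tangentSpaceAt ({0}ᶜ : Set E) x = ⊤ := fun x hx =>
    tangentSpaceAt_of_mem_nhds (isOpen_compl_singleton.mem_nhds hx)
  constructor
  · rintro ⟨⟨hS, hloc⟩, hmin⟩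
    refine ⟨hS, fun x hx => ?_⟩
    obtain ⟨U, F, hU, hxU, hF, hmem, hsurj⟩ := hloc x hx
    rw [htop x (hS hx), Submodule.top_coe, Set.surjOn_univ] at hsurj
    have hmem' : ∀ y ∈ U ∩ {0}ᶜ, y ∈ S ↔ F y = 0 := fun y hy => by
      rw [hmem y hy.1]; exact and_iff_right hy.2
    have hU' := hU.inter (isOpen_compl_singleton (x := (0 : E)))
    have hF' := hF.mono (Set.inter_subset_left (t := ({0}ᶜ : Set E)))
    exact ⟨U ∩ {0}ᶜ, F, hU', ⟨hxU, hS hx⟩, hF', hmem', hsurj,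
      (key hx (hS hx) hU' ⟨hxU, hS hx⟩ hF' hmem' hsurj).1 (hmin x hx)⟩
  · rintro ⟨hS, h⟩
    refine ⟨⟨hS, fun x hx => ?_⟩, fun x hx => ?_⟩
    · obtain ⟨U, F, hU, hxU, hF, hmem, hsurj, -⟩ := h x hx
      refine ⟨U, F, hU, hxU, hF, fun y hy => ⟨fun hyS => ⟨hS hyS, (hmem y hy).1 hyS⟩,
        fun hyF => (hmem y hy).2 hyF.2⟩, ?_⟩
      rw [htop x (hS hx), Submodule.top_coe, Set.surjOn_univ]
      exact hsurj
    · obtain ⟨U, F, hU, hxU, hF, hmem, hsurj, htr⟩ := h x hx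
      exact (key hx (hS hx) hU hxU hF hmem hsurj).2 htr

/-- A local equation of a cone vanishes along the ray through `x`, so its radial derivatives there
vanish and the spherical criterion applies. -/
theorem IsMinimalSubmanifold.inter_sphere {p : ℕ} {S : Set E}
    (h : IsMinimalSubmanifold {0}ᶜ p S) (hS : IsConical S) :
    IsMinimalSubmanifold (Metric.sphere (0 : E) 1) p (S ∩ Metric.sphere 0 1) := by
  have key : ∀ x ∈ S ∩ Metric.sphere (0 : E) 1, ∃ (U : Set E) (F : E → EuclideanSpace ℝ (Fin p)),
      IsOpen U ∧ x ∈ U ∧ ContDiffOn ℝ ∞ F U ∧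
      (∀ y ∈ U, y ∈ S ∩ Metric.sphere (0 : E) 1 ↔ y ∈ Metric.sphere (0 : E) 1 ∧ F y = 0) ∧
      Function.Surjective (fderiv ℝ F x) ∧ fderiv ℝ F x x = 0 ∧
      meanCurvature (Metric.sphere (0 : E) 1) (S ∩ Metric.sphere 0 1) x = 0 := by
    intro x hx
    obtain ⟨U, F, hU, hxU, hF, hmem, hsurj, htr⟩ :=
      (isMinimalSubmanifold_compl_zero_iff.1 h).2 x hx.1
    have hF2 : ContDiffAt ℝ 2 F x :=
      (hF.contDiffAt (hU.mem_nhds hxU)).two_of_infty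
    have hmem' : ∀ y ∈ U, y ∈ S ∩ Metric.sphere (0 : E) 1 ↔
        y ∈ Metric.sphere (0 : E) 1 ∧ F y = 0 := fun y hy => by
      rw [Set.mem_inter_iff, hmem y hy, and_comm]
    have hray : ∀ᶠ t in 𝓝 (1 : ℝ), F (t • x) = 0 := by
      have ht : Tendsto (fun t : ℝ => t • x) (𝓝 1) (𝓝 x) := by
        have : Continuous fun t : ℝ => t • x := by fun_prop
        simpa using this.tendsto 1
      filter_upwards [ht.eventually (hU.mem_nhds hxU), lt_mem_nhds zero_lt_one] with t h1 h2
      exact (hmem _ h1).1 (hS t h2 x hx.1)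
    have hFx := fderiv_self_eq_zero (hF2.differentiableAt (by norm_num)) hray
    exact ⟨U, F, hU, hxU, hF, hmem', hsurj, hFx, (meanCurvature_sphere_eq_zero_iff hF2
      (by filter_upwards [hU.mem_nhds hxU] using hmem') hsurj hFx
      (fderiv_fderiv_self_eq_zero hF2 hray) hx).2 htr⟩
  refine ⟨⟨Set.inter_subset_right, fun x hx => ?_⟩, fun x hx => ?_⟩
  · obtain ⟨U, F, hU, hxU, hF, hmem, hsurj, hFx, -⟩ := key x hx
    refine ⟨U, F, hU, hxU, hF, hmem, ?_⟩
    have hx1 : ‖x‖ = 1 := by simpa using hx.2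
    rw [tangentSpaceAt_sphere hx.2]
    intro w _
    obtain ⟨u, rfl⟩ := hsurj w
    -- Removing the radial part makes `u` tangent to the sphere and leaves `dF u` unchanged.
    refine ⟨u - ⟪x, u⟫_ℝ • x, ?_, by rw [map_sub, map_smul, hFx, smul_zero, sub_zero]⟩
    refine Submodule.mem_orthogonal_singleton_iff_inner_right.2 ?_
    rw [inner_sub_right, inner_smul_right, real_inner_self_eq_norm_sq, hx1]
    simp
  · obtain ⟨U, F, -, -, -, -, -, -, hmean⟩ := key x hx
    exact hmean

end MinimalSubmanifolds

/-! ### The cone over a minimal submanifold of the sphere -/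

section Cones

variable {E V : Type*} [NormedAddCommGroup E] [InnerProductSpace ℝ E] [FiniteDimensional ℝ E]
  [NormedAddCommGroup V] [NormedSpace ℝ V]

theorem isConical_Ioi_smul (B : Set E) : IsConical (Set.Ioi (0 : ℝ) • B) := by
  rintro t ht _ ⟨s, hs, b, hb, rfl⟩
  exact ⟨t * s, mul_pos ht hs, b, hb, mul_smul t s b⟩

theorem fderiv_fderiv_of_comp_smul {f : E → V} {c : ℝ} (hf : ∀ y, f (c • y) = f y) (x : E) :
    fderiv ℝ f x = c • fderiv ℝ f (c • x) ∧
      fderiv ℝ (fderiv ℝ f) x = c • c • fderiv ℝ (fderiv ℝ f) (c • x) := by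
  have h1 : ∀ y, fderiv ℝ f y = c • fderiv ℝ f (c • y) := fun y => by
    rw [← fderiv_comp_smul]
    simp_rw [hf]
  refine ⟨h1 x, ?_⟩
  conv_lhs => rw [show fderiv ℝ f = c • fun y => fderiv ℝ f (c • y) from funext h1]
  refine (congrFun (fderiv_const_smul_field (𝕜 := ℝ) (f := fun y => fderiv ℝ f (c • y)) c)
    x).trans ?_
  rw [Pi.smul_apply, fderiv_comp_smul]

theorem contDiffOn_normalize :
    ContDiffOn ℝ ∞ (fun y : E => ‖y‖⁻¹ • y) ({0}ᶜ : Set E) := fun _ hy =>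
  (((contDiffAt_norm ℝ hy).inv (norm_ne_zero_iff.2 hy)).smul contDiffAt_id).contDiffWithinAt

/-- Precomposing a local equation with `y ↦ y/‖y‖` makes it constant on rays, so it cuts out the
cone and has no radial derivatives. The criterion at `b` is then carried to `r • b` by scaling. -/
theorem IsMinimalSubmanifold.cone {p : ℕ} {B : Set E}
    (h : IsMinimalSubmanifold (Metric.sphere (0 : E) 1) p B) :
    IsMinimalSubmanifold {0}ᶜ p (Set.Ioi (0 : ℝ) • B) := by
  obtain ⟨⟨hB, hloc⟩, hmin⟩ := h
  refine isMinimalSubmanifold_compl_zero_iff.2 ⟨?_, ?_⟩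
  · rintro _ ⟨s, hs, b, hb, rfl⟩
    have hb1 : b ≠ 0 := ne_zero_of_mem_unit_sphere ⟨b, hB hb⟩
    exact smul_ne_zero (ne_of_gt hs) hb1
  rintro _ ⟨r, hr, b, hb, rfl⟩
  have hr : 0 < r := hr
  have hbs := hB hb
  have hb0 : b ≠ 0 := ne_zero_of_mem_unit_sphere ⟨b, hbs⟩
  obtain ⟨U, F, hU, hbU, hF, hmem, hsurj⟩ := hloc b hb
  set ν : E → E := fun y => ‖y‖⁻¹ • y with hν
  have hνs : ∀ y ∈ Metric.sphere (0 : E) 1, ν y = y := fun y hy => by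
    have : ‖y‖ = 1 := by simpa using hy
    simp [hν, this]
  have hνmem : ∀ y, y ≠ 0 → ν y ∈ Metric.sphere (0 : E) 1 := fun y hy => by
    simp [hν, norm_smul, hy]
  have hνsmul : ∀ t : ℝ, 0 < t → ∀ y, ν (t • y) = ν y := fun t ht y => by
    simp only [hν, norm_smul, Real.norm_of_nonneg ht.le, smul_smul]
    congr 1
    field_simp
  set U' : Set E := {0}ᶜ ∩ ν ⁻¹' U with hU'
  have hU'o : IsOpen U' :=
    contDiffOn_normalize.continuousOn.isOpen_inter_preimage isOpen_compl_singleton hU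
  have hbU' : b ∈ U' := ⟨hb0, by rw [Set.mem_preimage, hνs b hbs]; exact hbU⟩
  have hsmulU' : ∀ t : ℝ, 0 < t → ∀ y ∈ U', t • y ∈ U' := fun t ht y hy =>
    ⟨smul_ne_zero ht.ne' hy.1, by rw [Set.mem_preimage, hνsmul t ht]; exact hy.2⟩
  have hF' : ContDiffOn ℝ ∞ (F ∘ ν) U' :=
    hF.comp (contDiffOn_normalize.mono Set.inter_subset_left) fun y hy => hy.2
  have hFb : ContDiffAt ℝ 2 (F ∘ ν) b := (hF'.contDiffAt (hU'o.mem_nhds hbU')).two_of_infty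
  have hmemB : ∀ y ∈ U', y ∈ B ↔ y ∈ Metric.sphere (0 : E) 1 ∧ (F ∘ ν) y = 0 := by
    intro y hy
    constructor
    · intro hyB
      have hys := hB hyB
      refine ⟨hys, ?_⟩
      have hyU : ν y ∈ U := hy.2
      rw [Function.comp_apply, hνs y hys]
      rw [hνs y hys] at hyU
      exact ((hmem y hyU).1 hyB).2
    · rintro ⟨hys, hyF⟩
      have hyU : ν y ∈ U := hy.2
      rw [Function.comp_apply, hνs y hys] at hyF
      rw [hνs y hys] at hyU
      exact (hmem y hyU).2 ⟨hys, hyF⟩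
  have hmemC : ∀ y ∈ U', y ∈ Set.Ioi (0 : ℝ) • B ↔ (F ∘ ν) y = 0 := by
    intro y hy
    constructor
    · rintro ⟨s, hs, b', hb', rfl⟩
      have hs : 0 < s := hs
      have hb'U : b' ∈ U' := by
        have := hsmulU' s⁻¹ (inv_pos.2 hs) _ hy
        simpa [smul_smul, hs.ne'] using this
      rw [Function.comp_apply]
      simp only [hνsmul s hs]
      exact ((hmemB b' hb'U).1 hb').2
    · intro hy0
      have hy1 : y ≠ 0 := hy.1
      refine ⟨‖y‖, norm_pos_iff.2 hy1, ν y, ?_, ?_⟩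
      · exact (hmem _ hy.2).2 ⟨hνmem y hy1, hy0⟩
      · simp [hν, smul_smul, hy1]
  -- `F ∘ ν` and `F` agree on the sphere, hence so do their differentials on its tangent space,
  -- where that of `F` is already onto.
  have hsurjb : Function.Surjective (fderiv ℝ (F ∘ ν) b) := by
    intro w
    obtain ⟨u, hu, rfl⟩ := hsurj (Set.mem_univ w)
    refine ⟨u, ?_⟩
    have h1 : HasFDerivWithinAt F (fderiv ℝ F b) (Metric.sphere (0 : E) 1) b :=
      (((hF.contDiffAt (hU.mem_nhds hbU)).two_of_infty.differentiableAt
        (by norm_num)).hasFDerivAt).hasFDerivWithinAt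
    have h2 : HasFDerivWithinAt F (fderiv ℝ (F ∘ ν) b) (Metric.sphere (0 : E) 1) b :=
      (hFb.differentiableAt (by norm_num)).hasFDerivAt.hasFDerivWithinAt.congr
        (fun y hy => by rw [Function.comp_apply, hνs y hy])
        (by rw [Function.comp_apply, hνs b hbs])
    exact h2.eq_of_mem_tangentSpaceAt h1 hu
  have hray : ∀ᶠ t in 𝓝 (1 : ℝ), (F ∘ ν) (t • b) = (F ∘ ν) b := by
    filter_upwards [lt_mem_nhds (zero_lt_one (α := ℝ))] with t ht
    rw [Function.comp_apply, hνsmul t ht, Function.comp_apply]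
  have htr := (meanCurvature_sphere_eq_zero_iff hFb
    (by filter_upwards [hU'o.mem_nhds hbU'] using hmemB) hsurjb
    (fderiv_self_eq_zero (hFb.differentiableAt (by norm_num)) hray)
    (fderiv_fderiv_self_eq_zero hFb hray) hb).1 (hmin b hb)
  have hscale : ∀ y, (F ∘ ν) (r • y) = (F ∘ ν) y := fun y => by
    rw [Function.comp_apply, hνsmul r hr, Function.comp_apply]
  obtain ⟨hd1, hd2⟩ := fderiv_fderiv_of_comp_smul hscale b
  refine ⟨U', F ∘ ν, hU'o, hsmulU' r hr b hbU', hF', hmemC, ?_, ?_⟩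
  · intro w
    obtain ⟨u, rfl⟩ := hsurjb w
    exact ⟨r • u, by rw [hd1]; simp⟩
  · have hker : (fderiv ℝ (F ∘ ν) b).ker = (fderiv ℝ (F ∘ ν) (r • b)).ker := by
      ext u
      rw [hd1]
      simp [LinearMap.mem_ker, hr.ne']
    rw [hker, hd2] at htr
    simp only [traceOn, smul_apply, ← Finset.smul_sum] at htr
    exact ((smul_eq_zero.1 ((smul_eq_zero.1 htr).resolve_left hr.ne')).resolve_left hr.ne')

end Cones

/-! ### Second derivatives and traces under a horizontally conformal map -/

section Pullback

variable {E E' V : Type*} [NormedAddCommGroup E] [InnerProductSpace ℝ E] [FiniteDimensional ℝ E]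
  [NormedAddCommGroup E'] [InnerProductSpace ℝ E'] [FiniteDimensional ℝ E']
  [NormedAddCommGroup V] [NormedSpace ℝ V]

/-- The complement of `ker (L ∘ A)` is `Aᵀ((ker L)ᗮ)`, and `c⁻¹` normalises since `A Aᵀ = c`. -/
theorem starProjection_ker_comp {A : E →L[ℝ] E'} {c : ℝ} (hc : c ≠ 0)
    (hA : ∀ w, A (realAdjoint A w) = c • w) (L : E' →L[ℝ] V) (v : E) :
    (L ∘L A).ker.starProjection v = v - c⁻¹ • realAdjoint A (L.kerᗮ.starProjection (A v)) := by
  refine Submodule.eq_starProjection_of_mem_orthogonal ?_ ?_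
  · have h1 : L (A v - L.kerᗮ.starProjection (A v)) = 0 := by
      have : A v - L.kerᗮ.starProjection (A v) = L.ker.starProjection (A v) := by
        rw [Submodule.starProjection_orthogonal_val]; abel
      rw [this]
      exact Submodule.starProjection_apply_mem L.ker (A v)
    change L (A (v - c⁻¹ • realAdjoint A (L.kerᗮ.starProjection (A v)))) = 0
    rw [map_sub, map_smul, hA, smul_smul, inv_mul_cancel₀ hc, one_smul, h1]
  · rw [sub_sub_cancel, Submodule.mem_orthogonal]
    intro u hu
    rw [inner_smul_right, inner_realAdjoint_right]
    have : A u ∈ L.ker := hu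
    rw [Submodule.starProjection_apply_mem L.kerᗮ (A v) (A u) this, mul_zero]

/-- The trace of the second derivative of a composition over the kernel of its differential. -/
theorem traceOn_ker_comp {κ : Type*} [Fintype κ] (ε : OrthonormalBasis κ ℝ E) {A : E →L[ℝ] E'}
    {c : ℝ} (hc : c ≠ 0) (hA : ∀ w, A (realAdjoint A w) = c • w) {s : E →L[ℝ] E →L[ℝ] E'}
    (hs : ∑ k, s (ε k) (ε k) = 0) {L : E' →L[ℝ] V} {Q : E' →L[ℝ] E' →L[ℝ] V}
    (hN : ∀ ξ ∈ L.kerᗮ, ∀ ζ ∈ L.kerᗮ, ⟪ξ, s (realAdjoint A ζ) (realAdjoint A ζ)⟫_ℝ = 0)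
    (hQ : traceOn L.ker Q = 0) {B : E →L[ℝ] E →L[ℝ] V}
    (hB : ∀ u v, B u v = Q (A u) (A v) + L (s u v)) : traceOn (L ∘L A).ker B = 0 := by
  -- Up to the factor `c`, this is the trace of `s` over the complement of `ker (L ∘ A)`.
  have hN0 : ∑ k, s (ε k) (realAdjoint A (L.kerᗮ.starProjection (A (ε k)))) =
      ∑ j, s (realAdjoint A (stdOrthonormalBasis ℝ L.kerᗮ j))
        (realAdjoint A (stdOrthonormalBasis ℝ L.kerᗮ j)) := by
    rw [sum_apply_self_eq ε]
    simp_rw [starProjection_eq_sum, map_sum, map_smul, inner_realAdjoint_left]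
  have hLN : L (∑ k, s (ε k) (realAdjoint A (L.kerᗮ.starProjection (A (ε k))))) = 0 := by
    have : ∑ k, s (ε k) (realAdjoint A (L.kerᗮ.starProjection (A (ε k)))) ∈ L.kerᗮᗮ := by
      rw [Submodule.mem_orthogonal]
      intro ξ hξ
      rw [hN0, inner_sum]
      exact Finset.sum_eq_zero fun j _ => hN ξ hξ _ (Subtype.mem _)
    rw [Submodule.orthogonal_orthogonal] at this
    exact this
  -- Moving `A` across as an adjoint turns this sum into `c` times the trace of `Q` over `ker L`.
  have hT : ∑ k, Q (A (ε k)) (L.ker.starProjection (A (ε k))) = 0 := by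
    have h1 : ∑ k, Q (A (ε k)) (L.ker.starProjection (A (ε k))) =
        ∑ i, Q (A (realAdjoint A (stdOrthonormalBasis ℝ L.ker i : E')))
          (stdOrthonormalBasis ℝ L.ker i : E') := by
      simp_rw [starProjection_eq_sum, map_sum, map_smul]
      rw [Finset.sum_comm]
      refine Finset.sum_congr rfl fun i _ => ?_
      conv_rhs => rw [← ε.sum_repr' (realAdjoint A (stdOrthonormalBasis ℝ L.ker i : E'))]
      simp only [map_sum, map_smul, sum_apply, smul_apply, inner_realAdjoint_right]
      exact Finset.sum_congr rfl fun k _ => by rw [real_inner_comm]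
    rw [h1]
    simp_rw [hA, map_smul, smul_apply, ← Finset.smul_sum]
    rw [show ∑ i, Q (stdOrthonormalBasis ℝ L.ker i : E') (stdOrthonormalBasis ℝ L.ker i : E') = 0
      from hQ, smul_zero]
  have hAproj : ∀ v, A ((L ∘L A).ker.starProjection v) = L.ker.starProjection (A v) := fun v => by
    rw [starProjection_ker_comp hc hA, map_sub, map_smul, hA, smul_smul, inv_mul_cancel₀ hc,
      one_smul, Submodule.starProjection_orthogonal_val]
    abel
  rw [traceOn_eq_sum ε]
  simp_rw [hB, hAproj, Finset.sum_add_distrib]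
  rw [hT, zero_add, ← map_sum]
  simp_rw [starProjection_ker_comp hc hA, map_sub, map_smul, Finset.sum_sub_distrib,
    ← Finset.smul_sum]
  rw [hs, map_sub, map_zero, map_smul, hLN, smul_zero, sub_zero]

theorem fderiv_fderiv_comp_apply {f : E' → V} {P : E → E'} {x : E}
    (hf : ContDiffAt ℝ 2 f (P x)) (hP : ContDiffAt ℝ 2 P x) (u v : E) :
    fderiv ℝ (fderiv ℝ (f ∘ P)) x u v =
      fderiv ℝ (fderiv ℝ f) (P x) (fderiv ℝ P x u) (fderiv ℝ P x v) +
        fderiv ℝ f (P x) (fderiv ℝ (fderiv ℝ P) x u v) := by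
  have h1 : fderiv ℝ (f ∘ P) =ᶠ[𝓝 x] fun y => fderiv ℝ f (P y) ∘L fderiv ℝ P y := by
    filter_upwards [hP.eventually (by simp),
      hP.continuousAt.eventually (hf.eventually (by simp))] with y h1 h2
    exact fderiv_comp y (h2.differentiableAt (by norm_num)) (h1.differentiableAt (by norm_num))
  have hdf : DifferentiableAt ℝ (fderiv ℝ f) (P x) :=
    (hf.fderiv_right (m := 1) (by norm_num)).differentiableAt (by norm_num)
  have hdP : DifferentiableAt ℝ (fderiv ℝ P) x :=
    (hP.fderiv_right (m := 1) (by norm_num)).differentiableAt (by norm_num)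
  have h2 := (hdf.hasFDerivAt.comp x (hP.differentiableAt (by norm_num)).hasFDerivAt).clm_comp
    hdP.hasFDerivAt
  rw [h1.fderiv_eq]
  have h3 := congrArg (fun T => T u v) h2.fderiv
  simp only [Function.comp_def] at h3
  rw [h3]
  simp [add_comm]

end Pullback

/-! ### Homogeneous harmonic morphisms and the umbilic condition -/

section HarmonicMorphisms

variable {m n d : ℕ} {P : EuclideanSpace ℝ (Fin m) → EuclideanSpace ℝ (Fin n)}

theorem IsHomogeneousPolynomialMap.contDiff (hP : IsHomogeneousPolynomialMap d P) :
    ContDiff ℝ ∞ P := by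
  obtain ⟨q, -, hq⟩ := hP
  rw [contDiff_euclidean]
  intro i
  simp_rw [hq]
  have h := (AnalyticOnNhd.eval_continuousLinearMap
    (EuclideanSpace.equiv (Fin m) ℝ).toContinuousLinearMap (q i)).contDiffOn (n := ∞)
    uniqueDiffOn_univ
  exact contDiffOn_univ.1 h

theorem IsHomogeneousPolynomialMap.map_smul (hP : IsHomogeneousPolynomialMap d P) (t : ℝ)
    (x : EuclideanSpace ℝ (Fin m)) : P (t • x) = t ^ d • P x := by
  obtain ⟨q, hd, hq⟩ := hP
  ext i
  rw [hq, PiLp.smul_apply, hq, smul_eq_mul]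
  rw [MvPolynomial.eval_eq', MvPolynomial.eval_eq', Finset.mul_sum]
  refine Finset.sum_congr rfl fun e he => ?_
  have hdeg : ∑ j, e j = d := by
    rw [← Finsupp.degree_eq_sum, Finsupp.degree_eq_weight_one]
    exact hd i (MvPolynomial.mem_support_iff.1 he)
  simp_rw [PiLp.smul_apply, smul_eq_mul, mul_pow]
  rw [Finset.prod_mul_distrib, Finset.prod_pow_eq_pow_sum, hdeg]
  ring

theorem IsHomogeneousPolynomialMap.fderiv_self (hP : IsHomogeneousPolynomialMap d P)
    (x : EuclideanSpace ℝ (Fin m)) : fderiv ℝ P x x = (d : ℝ) • P x := by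
  have h1 : HasDerivAt (fun t : ℝ => t • x) x 1 := by
    simpa using (hasDerivAt_id (1 : ℝ)).smul_const x
  have hd : HasFDerivAt P (fderiv ℝ P x) ((1 : ℝ) • x) := by
    rw [one_smul]
    exact (hP.contDiff.differentiable (by simp) x).hasFDerivAt
  have h2 := hd.comp_hasDerivAt 1 h1
  have h3 : HasDerivAt (fun t : ℝ => t ^ d • P x) ((d : ℝ) • P x) 1 := by
    simpa using (hasDerivAt_pow d (1 : ℝ)).smul_const (P x)
  refine h2.unique (h3.congr_of_eventuallyEq (Eventually.of_forall fun t => ?_))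
  exact hP.map_smul t x

theorem laplacian_eq_sum_fderiv {F : Type*} [NormedAddCommGroup F] [NormedSpace ℝ F] {k : ℕ}
    (f : EuclideanSpace ℝ (Fin k) → F) (x : EuclideanSpace ℝ (Fin k)) :
    Laplacian.laplacian f x = ∑ j, fderiv ℝ (fderiv ℝ f) x (EuclideanSpace.basisFun (Fin k) ℝ j)
      (EuclideanSpace.basisFun (Fin k) ℝ j) := by
  rw [InnerProductSpace.laplacian_eq_iteratedFDeriv_orthonormalBasis f
    (EuclideanSpace.basisFun (Fin k) ℝ)]
  simp [iteratedFDeriv_two_apply]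

theorem IsHarmonicMorphism.sum_fderiv_comp_eq_zero (hP : IsHarmonicMorphism P)
    (hPs : ContDiff ℝ 2 P) {f : EuclideanSpace ℝ (Fin n) → ℝ} (hf : ContDiff ℝ 2 f)
    (h0 : ∀ y, ∑ j, fderiv ℝ (fderiv ℝ f) y (EuclideanSpace.basisFun (Fin n) ℝ j)
      (EuclideanSpace.basisFun (Fin n) ℝ j) = 0) (x : EuclideanSpace ℝ (Fin m)) :
    ∑ j, fderiv ℝ (fderiv ℝ f) (P x) (fderiv ℝ P x (EuclideanSpace.basisFun (Fin m) ℝ j))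
        (fderiv ℝ P x (EuclideanSpace.basisFun (Fin m) ℝ j)) +
      fderiv ℝ f (P x) (∑ j, fderiv ℝ (fderiv ℝ P) x (EuclideanSpace.basisFun (Fin m) ℝ j)
        (EuclideanSpace.basisFun (Fin m) ℝ j)) = 0 := by
  have hh : InnerProductSpace.HarmonicOnNhd f Set.univ := fun y _ =>
    ⟨hf.contDiffAt, Eventually.of_forall fun z => by
      rw [laplacian_eq_sum_fderiv]; exact h0 z⟩
  have h1 := (hP Set.univ f isOpen_univ hh x trivial).2.self_of_nhds
  rw [laplacian_eq_sum_fderiv] at h1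
  simp_rw [fderiv_fderiv_comp_apply hf.contDiffAt hPs.contDiffAt, Finset.sum_add_distrib] at h1
  rw [map_sum]
  exact h1

/-- Linear functions are harmonic, so the components of `P` are. -/
theorem IsHarmonicMorphism.sum_fderiv_eq_zero (hP : IsHarmonicMorphism P)
    (hPs : ContDiff ℝ 2 P) (x : EuclideanSpace ℝ (Fin m)) :
    ∑ j, fderiv ℝ (fderiv ℝ P) x (EuclideanSpace.basisFun (Fin m) ℝ j)
        (EuclideanSpace.basisFun (Fin m) ℝ j) = 0 := by
  refine ext_inner_left ℝ fun ξ => ?_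
  have hd : fderiv ℝ (innerSL ℝ ξ : EuclideanSpace ℝ (Fin n) → ℝ) = fun _ => innerSL ℝ ξ :=
    funext fun y => (innerSL ℝ ξ).fderiv
  have h := hP.sum_fderiv_comp_eq_zero hPs (f := innerSL ℝ ξ) (innerSL ℝ ξ).contDiff
    (fun y => by rw [hd]; simp) x
  rw [hd] at h
  rw [inner_sum]
  simpa using h

theorem fderiv_bilinear_self {E : Type*} [NormedAddCommGroup E] [NormedSpace ℝ E]
    (b : E →L[ℝ] E →L[ℝ] ℝ) : fderiv ℝ (fun y => b y y) = fun y => (b + b.flip) y := by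
  funext y
  have h : HasFDerivAt (fun y => b y y) _ y := b.hasFDerivAt.clm_apply (hasFDerivAt_id y)
  rw [h.fderiv]
  ext v
  simp

/-- The inner product as a continuous bilinear map. -/
def realInnerCLM (E : Type*) [NormedAddCommGroup E] [InnerProductSpace ℝ E] : E →L[ℝ] E →L[ℝ] ℝ :=
  (innerₗ E).mkContinuous₂ 1 fun u v => by simpa using norm_inner_le_norm (𝕜 := ℝ) u v

/-- A harmonic morphism is horizontally weakly conformal. -/
theorem IsHarmonicMorphism.inner_realAdjoint (hP : IsHarmonicMorphism P)
    (hPs : ContDiff ℝ 2 P) (x : EuclideanSpace ℝ (Fin m)) (ξ ζ : EuclideanSpace ℝ (Fin n)) :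
    n * ⟪realAdjoint (fderiv ℝ P x) ξ, realAdjoint (fderiv ℝ P x) ζ⟫_ℝ =
      hilbertSchmidtSq P x * ⟪ξ, ζ⟫_ℝ := by
  -- The form `n⟪ξ,y⟫⟪ζ,y⟫ - ⟪ξ,ζ⟫‖y‖²` is trace-free, hence harmonic; as `ΔP = 0`, pulling it back
  -- leaves only first derivatives of `P`.
  set b : EuclideanSpace ℝ (Fin n) →L[ℝ] EuclideanSpace ℝ (Fin n) →L[ℝ] ℝ :=
    (n : ℝ) • (innerSL ℝ ξ).smulRight (innerSL ℝ ζ) - ⟪ξ, ζ⟫_ℝ • realInnerCLM _ with hb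
  have hbuu : ∀ u, b u u = n * (⟪ξ, u⟫_ℝ * ⟪ζ, u⟫_ℝ) - ⟪ξ, ζ⟫_ℝ * ‖u‖ ^ 2 := fun u => by
    simp [hb, realInnerCLM]
  have hd2 : fderiv ℝ (fderiv ℝ fun y => b y y) = fun _ => b + b.flip := by
    rw [fderiv_bilinear_self]
    exact funext fun y => (b + b.flip).fderiv
  have hf : ContDiff ℝ 2 fun y => b y y := b.contDiff.clm_apply contDiff_id
  have h := hP.sum_fderiv_comp_eq_zero hPs hf (fun y => by
    rw [hd2]
    simp only [add_apply, ContinuousLinearMap.flip_apply, hbuu, Finset.sum_add_distrib,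
      Finset.sum_sub_distrib, ← Finset.mul_sum]
    have h1 := (EuclideanSpace.basisFun (Fin n) ℝ).sum_inner_mul_inner ξ ζ
    simp_rw [real_inner_comm ζ] at h1
    rw [h1, real_inner_comm]
    simp
    ring) x
  rw [hP.sum_fderiv_eq_zero hPs, map_zero, add_zero] at h
  rw [hd2] at h
  simp only [add_apply, ContinuousLinearMap.flip_apply, hbuu, Finset.sum_add_distrib,
      Finset.sum_sub_distrib, ← Finset.mul_sum, ← inner_realAdjoint_left] at h
  have h1 := (EuclideanSpace.basisFun (Fin m) ℝ).sum_inner_mul_inner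
    (realAdjoint (fderiv ℝ P x) ξ) (realAdjoint (fderiv ℝ P x) ζ)
  simp_rw [real_inner_comm (realAdjoint (fderiv ℝ P x) ζ)] at h1
  rw [h1, real_inner_comm] at h
  rw [hilbertSchmidtSq]
  linarith

theorem IsHarmonicMorphism.apply_realAdjoint (hP : IsHarmonicMorphism P)
    (hPs : ContDiff ℝ 2 P) (hn : n ≠ 0) (x : EuclideanSpace ℝ (Fin m))
    (w : EuclideanSpace ℝ (Fin n)) :
    fderiv ℝ P x (realAdjoint (fderiv ℝ P x) w) = (hilbertSchmidtSq P x / n) • w := by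
  refine ext_inner_left ℝ fun ξ => ?_
  have hn' : (n : ℝ) ≠ 0 := by exact_mod_cast hn
  have h := hP.inner_realAdjoint hPs x ξ w
  rw [inner_realAdjoint_left] at h
  rw [inner_smul_right]
  field_simp
  linarith

theorem differentiable_hilbertSchmidtSq (hPs : ContDiff ℝ 2 P) :
    Differentiable ℝ (hilbertSchmidtSq P) := by
  have hd : Differentiable ℝ (fderiv ℝ P) :=
    (hPs.fderiv_right (m := 1) (by norm_num)).differentiable (by norm_num)
  unfold hilbertSchmidtSq
  exact Differentiable.fun_sum fun j _ => (hd.clm_apply (differentiable_const _)).norm_sq ℝ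

/-- This is the derivative of `inner_realAdjoint` in the direction `w`. -/
theorem IsHarmonicMorphism.fderiv_hilbertSchmidtSq (hP : IsHarmonicMorphism P)
    (hPs : ContDiff ℝ 2 P) (x w : EuclideanSpace ℝ (Fin m)) (ξ ζ : EuclideanSpace ℝ (Fin n)) :
    n * (⟪ξ, fderiv ℝ (fderiv ℝ P) x w (realAdjoint (fderiv ℝ P x) ζ)⟫_ℝ +
        ⟪ζ, fderiv ℝ (fderiv ℝ P) x w (realAdjoint (fderiv ℝ P x) ξ)⟫_ℝ) =
      fderiv ℝ (hilbertSchmidtSq P) x w * ⟪ξ, ζ⟫_ℝ := by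
  have hd : HasFDerivAt (fderiv ℝ P) (fderiv ℝ (fderiv ℝ P) x) x :=
    ((hPs.fderiv_right (m := 1) (by norm_num)).differentiable (by norm_num) x).hasFDerivAt
  have ha : ∀ η, HasFDerivAt (fun y => realAdjoint (fderiv ℝ P y) η) _ x := fun η =>
    ((realAdjoint.hasFDerivAt.comp x hd).clm_apply (hasFDerivAt_const η x))
  have h1 := ((ha ξ).inner ℝ (ha ζ)).const_mul (n : ℝ)
  have h2 := ((differentiable_hilbertSchmidtSq hPs x).hasFDerivAt).mul_const ⟪ξ, ζ⟫_ℝ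
  simp_rw [hP.inner_realAdjoint hPs] at h1
  have h3 := congrArg (fun T => T w) (h1.unique h2)
  simp at h3
  rw [inner_realAdjoint_left (fderiv ℝ (fderiv ℝ P) x w) ξ,
    inner_realAdjoint_right (fderiv ℝ (fderiv ℝ P) x w) ζ, real_inner_comm ζ] at h3
  linarith

/-- With `w = Aᵀζ` the differentiated conformality relation gives `⟪ξ, s(Aᵀζ,Aᵀζ)⟫ = -⟪ζ,
s(Aᵀζ,Aᵀξ)⟫`; with `w = Aᵀξ` and both normals equal to `ζ`, the right side is zero by symmetry of
`s`. -/
theorem inner_fderiv_fderiv_eq_zero (hP : IsHarmonicMorphism P) (humb : IsUmbilic P)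
    (hPs : ContDiff ℝ 2 P) (hn : n ≠ 0) (x : EuclideanSpace ℝ (Fin m))
    {ξ ζ : EuclideanSpace ℝ (Fin n)} (hξ : ⟪P x, ξ⟫_ℝ = 0) (hζ : ⟪P x, ζ⟫_ℝ = 0) :
    ⟪ξ, fderiv ℝ (fderiv ℝ P) x (realAdjoint (fderiv ℝ P x) ζ)
      (realAdjoint (fderiv ℝ P x) ζ)⟫_ℝ = 0 := by
  obtain ⟨η, hη⟩ := humb
  have hn' : (n : ℝ) ≠ 0 := by exact_mod_cast hn
  have hzero : ∀ v, ⟪P x, v⟫_ℝ = 0 →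
      fderiv ℝ (hilbertSchmidtSq P) x (realAdjoint (fderiv ℝ P x) v) = 0 := by
    intro v hv
    have h : ⟪gradient (hilbertSchmidtSq P) x, realAdjoint (fderiv ℝ P x) v⟫_ℝ =
        fderiv ℝ (hilbertSchmidtSq P) x (realAdjoint (fderiv ℝ P x) v) :=
      InnerProductSpace.toDual_symm_apply
    rw [← h, inner_realAdjoint_right, hη, inner_smul_left, hv, mul_zero]
  have hsymm : IsSymmSndFDerivAt ℝ P x := hPs.contDiffAt.isSymmSndFDerivAt (by simp)
  have h1 := hP.fderiv_hilbertSchmidtSq hPs x (realAdjoint (fderiv ℝ P x) ζ) ξ ζ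
  have h2 := hP.fderiv_hilbertSchmidtSq hPs x (realAdjoint (fderiv ℝ P x) ξ) ζ ζ
  rw [hzero ζ hζ, zero_mul, mul_eq_zero, or_iff_right hn'] at h1
  rw [hzero ξ hξ, zero_mul, mul_eq_zero, or_iff_right hn', hsymm] at h2
  linarith

theorem IsMinimalSubmanifold.preimage {p : ℕ} {C : Set (EuclideanSpace ℝ (Fin n))} (hd : 1 ≤ d)
    (hP : IsHomogeneousPolynomialMap d P) (hharm : IsHarmonicMorphism P) (humb : IsUmbilic P)
    (hC : IsMinimalSubmanifold {0}ᶜ p C) (hcone : IsConical C) :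
    IsMinimalSubmanifold {0}ᶜ p (P ⁻¹' C) := by
  obtain ⟨hC0, hloc⟩ := isMinimalSubmanifold_compl_zero_iff.1 hC
  have hPs : ContDiff ℝ 2 P := contDiff_infty.1 hP.contDiff 2
  refine isMinimalSubmanifold_compl_zero_iff.2 ⟨?_, fun x hx => ?_⟩
  · rintro x hx rfl
    refine hC0 hx ?_
    have := hP.map_smul 0 0
    rwa [zero_smul, zero_pow (by omega), zero_smul] at this
  obtain ⟨U, F, hU, hxU, hF, hmem, hsurj, htr⟩ := hloc (P x) hx
  have hPx : P x ≠ 0 := hC0 hx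
  have hn : n ≠ 0 := by
    rintro rfl
    exact hPx (Subsingleton.elim _ _)
  have hn' : (n : ℝ) ≠ 0 := by exact_mod_cast hn
  have hA := hharm.apply_realAdjoint hPs hn x
  -- If the dilation vanished, so would `Aᵀ(P x)`; pairing it with `x` gives `d‖P x‖² = 0` by
  -- Euler's identity, which is impossible.
  have hc : hilbertSchmidtSq P x / n ≠ 0 := by
    intro h0
    rw [h0] at hA
    simp_rw [zero_smul] at hA
    have h1 : realAdjoint (fderiv ℝ P x) (P x) = 0 := by
      rw [← inner_self_eq_zero (𝕜 := ℝ), inner_realAdjoint_left, hA, inner_zero_right]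
    have h2 := inner_realAdjoint_left (fderiv ℝ P x) (P x) x
    rw [h1, inner_zero_left, hP.fderiv_self, inner_smul_right, eq_comm, mul_eq_zero,
      inner_self_eq_zero, Nat.cast_eq_zero] at h2
    rcases h2 with h2 | h2
    · omega
    · exact hPx h2
  have hFx : ContDiffAt ℝ 2 F (P x) := (hF.contDiffAt (hU.mem_nhds hxU)).two_of_infty
  have hray : ∀ᶠ t in 𝓝 (1 : ℝ), F (t • P x) = 0 := by
    have ht : Tendsto (fun t : ℝ => t • P x) (𝓝 1) (𝓝 (P x)) := by
      have : Continuous fun t : ℝ => t • P x := by fun_prop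
      simpa using this.tendsto 1
    filter_upwards [ht.eventually (hU.mem_nhds hxU), lt_mem_nhds zero_lt_one] with t h1 h2
    exact (hmem _ h1).1 (hcone t h2 _ hx)
  have hFP : fderiv ℝ F (P x) (P x) = 0 :=
    fderiv_self_eq_zero (hFx.differentiableAt (by norm_num)) hray
  have hcomp : fderiv ℝ (F ∘ P) x = fderiv ℝ F (P x) ∘L fderiv ℝ P x :=
    fderiv_comp x (hFx.differentiableAt (by norm_num)) (hPs.differentiable (by norm_num) x)
  refine ⟨P ⁻¹' U, F ∘ P, hU.preimage hP.contDiff.continuous, hxU,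
    hF.comp hP.contDiff.contDiffOn fun y hy => hy, fun y hy => hmem (P y) hy, ?_, ?_⟩
  · intro w
    obtain ⟨u, rfl⟩ := hsurj w
    refine ⟨(hilbertSchmidtSq P x / n)⁻¹ • realAdjoint (fderiv ℝ P x) u, ?_⟩
    rw [hcomp, ContinuousLinearMap.comp_apply, map_smul, hA, smul_smul, inv_mul_cancel₀ hc,
      one_smul]
  · rw [hcomp]
    -- `C` is conical, so `P x` is itself tangent to `C` and orthogonal to its normals.
    have horth : ∀ ξ ∈ (fderiv ℝ F (P x)).kerᗮ, ⟪P x, ξ⟫_ℝ = 0 := fun ξ hξ => hξ (P x) hFP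
    exact traceOn_ker_comp (EuclideanSpace.basisFun (Fin m) ℝ) hc hA
      (hharm.sum_fderiv_eq_zero hPs x)
      (fun ξ hξ ζ hζ => inner_fderiv_fderiv_eq_zero hharm humb hPs hn x (horth ξ hξ) (horth ζ hζ))
      htr (fderiv_fderiv_comp_apply hFx hPs.contDiffAt)

theorem IsHomogeneousPolynomialMap.isConical_preimage {C : Set (EuclideanSpace ℝ (Fin n))}
    (hP : IsHomogeneousPolynomialMap d P) (hC : IsConical C) : IsConical (P ⁻¹' C) := by
  intro t ht x hx
  rw [Set.mem_preimage, hP.map_smul]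
  exact hC _ (pow_pos ht d) _ hx

end HarmonicMorphisms

end

theorem mainTheorem7 {m n d : ℕ} (hd : 1 ≤ d)
    (P : EuclideanSpace ℝ (Fin m) → EuclideanSpace ℝ (Fin n))
    (hP : IsHomogeneousPolynomialMap d P)
    (hharm : IsHarmonicMorphism P)
    (humb : IsUmbilic P) :
    (∀ (p : ℕ) (C : Set (EuclideanSpace ℝ (Fin n))),
      IsMinimalSubmanifold {0}ᶜ p C → IsConical C →
        IsMinimalSubmanifold {0}ᶜ p (P ⁻¹' C) ∧ IsConical (P ⁻¹' C)) ∧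
    (∀ (p : ℕ) (B : Set (EuclideanSpace ℝ (Fin n))),
      IsMinimalSubmanifold (Metric.sphere 0 1) p B →
        IsMinimalSubmanifold (Metric.sphere 0 1) p
          (P ⁻¹' (Set.Ioi (0 : ℝ) • B) ∩ Metric.sphere 0 1)) :=
  ⟨fun _ _ hC hcone => ⟨hC.preimage hd hP hharm humb hcone, hP.isConical_preimage hcone⟩,
    fun _ B hB => (hB.cone.preimage hd hP hharm humb (isConical_Ioi_smul B)).inter_sphere
      (hP.isConical_preimage (isConical_Ioi_smul B))⟩
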